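/- Let $\mathbb T=\mathbb R/2\pi\mathbb Z$, let $L^2=L^2(\mathbb T^2;\mathbb C)$, and write $\hat f(k)$, $k=(k_1,k_2)\in\mathbb Z^2$, for the Fourier coefficients of a periodic distribution $f$. Put $\varphi(k)=k_1^3+3k_1k_2^2$ and let $e^{it\varphi(\nabla/i)}$ be the Fourier multiplier with symbol $e^{it\varphi(k)}$, that is, the propagator of $\partial_tu+\partial_x^3u+3\partial_x\partial_y^2u=0$. For dyadic $N\in\{1,2,4,\dots\}$ let $P_N$ be the Fourier multiplier with symbol $1_{[N,2N)}(|k|)$ if $N\ge2$ and $1_{[0,2)}(|k|)$ if $N=1$. For a bounded interval $I=[a,b)$, a $U^2(I)$-atom is a step function $\sum_{k=1}^K\phi_{k-1}\chi_{[t_{k-1},t_k)}$ with $a=t_0<\dots<t_K=b$, $\phi_k\in L^2$ and $\sum_{k}\|\phi_k\|_{L^2}^2=1$, and $$\|f\|_{U^2(I)}=\inf\Big\{\sum_n|\lambda_n| : f=\sum_n\lambda_na_n \text{ pointwise on } I,\ a_n \text{ a } U^2(I)\text{-atom}\Big\}.$$ Moreover $\|f\|_{DU^2(I)}=\|w\|_{U^2(I)}$,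 where $w\in U^2(I)$ satisfies $\partial_tw=f$ in the sense of distributions on $(a,b)$ and $\lim_{t\uparrow b}w(t)=0$. Norms are $\infty$ if there is no such representation or no such $w$. Set $\|f\|_{U^2_\varphi(I)}=\|e^{-it\varphi(\nabla/i)}f\|_{U^2(I)}$ and $\|f\|_{DU^2_\varphi(I)}=\|e^{-it\varphi(\nabla/i)}f\|_{DU^2(I)}$. For $T\in(0,1]$ and $s\ge0$ define $$\|u\|_{F^s_{ZK}(T)}^2=\sum_{N}N^{2s}\sup_I\|P_Nu\|_{U^2_\varphi(I)}^2,\qquad \|f\|_{N^s_{ZK}(T)}^2=\sum_{N}N^{2s}\sup_I\|P_Nf\|_{DU^2_\varphi(I)}^2,$$ where, for each $N$, the supremum runs over the intervals $I=[a,b)\subseteq[0,T)$ of length $\min(N^{-2},T)$. Then for every $s>0$ there is a constant $C=C(s)$ such that for all $T\in(0,1]$ and all $L^2$-valued functions $u,v$ of time $$\|\partial_x(uv)\|_{N^s_{ZK}(T)}\le C\,\|u\|_{F^s_{ZK}(T)}\|v\|_{F^s_{ZK}(T)},\qquad \|\partial_x(uv)\|_{N^0_{ZK}(T)}\le C\,\|u\|_{F^0_{ZK}(T)}\|v\|_{F^s_{ZK}(T)}$$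 (with the convention $0\cdot\infty=0$). Here $\partial_x(uv)(t)$ is the distributional derivative in the first variable of $u(t)v(t)\in L^1(\mathbb T^2)$. -/

import Mathlib

open MeasureTheory Set Filter Topology
open scoped ENNReal NNReal ContDiff

namespace ZK

/-! The torus `𝕋² = (ℝ/2πℤ)²` is parametrized by `UnitAddTorus (Fin 2)` through `x = 2πθ`, so that
the character `x ↦ exp(i k·x)`, `k ∈ ℤ²`, is `UnitAddTorus.mFourier k`, the measure is normalized
Haar measure, and `∂_x`, `φ(∇/i)`, `P_N` are the Fourier multipliers with symbols `i k₁`, `φ(k)`,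
`1_{[N,2N)}(|k|)` in the integer frequency `k`. -/

/-- The Hilbert space `L²(𝕋²; ℂ)` for normalized Haar measure. -/
noncomputable abbrev L2 : Type :=
  Lp ℂ 2 (Measure.pi (fun _ : Fin 2 => (AddCircle.haarAddCircle : Measure UnitAddCircle)))

/-- A periodic distribution, given by its Fourier coefficients. -/
abbrev Coeffs : Type := (Fin 2 → ℤ) → ℂ

/-- The Euclidean length of a frequency `k ∈ ℤ²`. -/
noncomputable def freqNorm (k : Fin 2 → ℤ) : ℝ := Real.sqrt ((k 0 : ℝ) ^ 2 + (k 1 : ℝ) ^ 2)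

/-- The frequencies of the Littlewood–Paley block `N = 2 ^ j`: `N ≤ |k| < 2N` if `j ≥ 1`, and
`|k| < 2` if `j = 0`. -/
def annulus (j : ℕ) : Set (Fin 2 → ℤ) :=
  {k | freqNorm k < 2 ^ (j + 1) ∧ (j = 0 ∨ (2 : ℝ) ^ j ≤ freqNorm k)}

theorem annulus_finite (j : ℕ) : (annulus j).Finite := by
  refine Set.Finite.subset
    (Set.finite_Icc (fun _ : Fin 2 => -(2 : ℤ) ^ (j + 1)) (fun _ => (2 : ℤ) ^ (j + 1))) ?_
  intro k hk
  have h1 := hk.1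
  have key : ∀ i, |(k i : ℝ)| ≤ 2 ^ (j + 1) := by
    intro i
    refine le_trans (Real.abs_le_sqrt ?_) h1.le
    fin_cases i
    · simpa using sq_nonneg (k 1 : ℝ)
    · simpa using sq_nonneg (k 0 : ℝ)
  refine ⟨fun i => ?_, fun i => ?_⟩
  · have := (abs_le.1 (key i)).1
    exact_mod_cast this
  · have := (abs_le.1 (key i)).2
    exact_mod_cast this

/-- The Littlewood–Paley projection `P_N`, `N = 2 ^ j`, of a periodic distribution; it is a
trigonometric polynomial. -/
noncomputable def lpProj (j : ℕ) (c : Coeffs) : L2 :=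
  ∑ k ∈ (annulus_finite j).toFinset, c k • UnitAddTorus.mFourierLp 2 k

/-- The Zakharov–Kuznetsov dispersion relation `φ(k) = k₁³ + 3 k₁ k₂²`. -/
noncomputable def phase (k : Fin 2 → ℤ) : ℝ := (k 0 : ℝ) ^ 3 + 3 * (k 0 : ℝ) * (k 1 : ℝ) ^ 2

theorem memlp_phase (t : ℝ) (f : L2) :
    Memℓp (fun k => Complex.exp (Complex.I * ((t * phase k : ℝ) : ℂ)) *
      UnitAddTorus.mFourierBasis.repr f k) 2 := by
  refine (lp.memℓp (UnitAddTorus.mFourierBasis.repr f)).mono' fun k => ?_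
  rw [norm_mul, mul_comm Complex.I, Complex.norm_exp_ofReal_mul_I, one_mul]

/-- The propagator `exp(i t φ(∇/i))` on `L²(𝕋²)`; it solves `∂_t u + ∂_x³ u + 3 ∂_x ∂_y² u = 0`. -/
noncomputable def propagator (t : ℝ) (f : L2) : L2 :=
  UnitAddTorus.mFourierBasis.repr.symm
    ⟨fun k => Complex.exp (Complex.I * ((t * phase k : ℝ) : ℂ)) *
      UnitAddTorus.mFourierBasis.repr f k, memlp_phase t f⟩

/-- `f` is a `U²([a,b))`-atom: a step function along a partition `a = t₀ < ⋯ < t_K = b` whose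
values `φ₀, …, φ_{K-1}` in `L²` satisfy `∑ ‖φ_k‖² = 1`. -/
def IsAtom (a b : ℝ) (f : ℝ → L2) : Prop :=
  ∃ (K : ℕ) (t : ℕ → ℝ) (φ : ℕ → L2),
    t 0 = a ∧ t K = b ∧ (∀ k < K, t k < t (k + 1)) ∧
    ∑ k ∈ Finset.range K, ‖φ k‖ ^ 2 = 1 ∧
    ∀ x ∈ Ico a b, f x = ∑ k ∈ Finset.range K, (Ico (t k) (t (k + 1))).indicator (fun _ => φ k) x

/-- The `U²([a,b))`-norm (with value `∞` if `f ∉ U²`). -/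
noncomputable def normU2 (a b : ℝ) (f : ℝ → L2) : ℝ≥0∞ :=
  ⨅ (l : ℕ → ℂ) (A : ℕ → ℝ → L2) (_ : ∀ n, IsAtom a b (A n))
    (_ : ∀ x ∈ Ico a b, HasSum (fun n => l n • A n x) (f x)), ∑' n, ‖l n‖ₑ

/-- `∂_t w = f` on `(a,b)` in the sense of `L²(𝕋²)`-valued distributions. -/
def HasWeakTimeDeriv (a b : ℝ) (w f : ℝ → L2) : Prop :=
  LocallyIntegrableOn w (Ioo a b) ∧ LocallyIntegrableOn f (Ioo a b) ∧
  ∀ ψ : ℝ → ℂ, ContDiff ℝ ∞ ψ → HasCompactSupport ψ → tsupport ψ ⊆ Ioo a b →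
    ∫ x, deriv ψ x • w x = - ∫ x, ψ x • f x

/-- The `DU²([a,b))`-norm: the `U²`-norm of the primitive of `f` whose limit at the right endpoint
`b` is zero (with value `∞` if there is no such primitive in `U²`). -/
noncomputable def normDU2 (a b : ℝ) (f : ℝ → L2) : ℝ≥0∞ :=
  ⨅ (w : ℝ → L2) (_ : Tendsto w (𝓝[<] b) (𝓝 0)) (_ : HasWeakTimeDeriv a b w f), normU2 a b w

/-- The norm of `U²_φ([a,b); L²)`. -/
noncomputable def normU2ZK (a b : ℝ) (f : ℝ → L2) : ℝ≥0∞ :=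
  normU2 a b (fun t => propagator (-t) (f t))

/-- The norm of `DU²_φ([a,b); L²)`. -/
noncomputable def normDU2ZK (a b : ℝ) (f : ℝ → L2) : ℝ≥0∞ :=
  normDU2 a b (fun t => propagator (-t) (f t))

/-- The length `min(N⁻², T)`, `N = 2 ^ j`, of the time windows within `[0,T)` for frequencies `N`. -/
noncomputable def window (T : ℝ) (j : ℕ) : ℝ := min (((2 : ℝ) ^ j) ^ (-2 : ℤ)) T

/-- The short-time norm `(∑_N N^{2s} sup_I ‖P_N f‖²_{X(I)})^{1/2}`, `N = 2 ^ j`, where `I` runs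
through the intervals `[a,b) ⊆ [0,T)` of length `min(N⁻², T)` and `X` is a scale of norms on
`L²`-valued functions on `[a,b)`. -/
noncomputable def shortTimeNorm (X : ℝ → ℝ → (ℝ → L2) → ℝ≥0∞) (T s : ℝ) (f : ℝ → Coeffs) : ℝ≥0∞ :=
  (∑' j : ℕ, ENNReal.ofReal (((2 : ℝ) ^ j) ^ (2 * s)) *
    (⨆ (a : ℝ) (_ : 0 ≤ a) (_ : a + window T j ≤ T),
      X a (a + window T j) (fun t => lpProj j (f t))) ^ 2) ^ (1 / 2 : ℝ)

/-- The norm of `F^s_{ZK}(T)`. -/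
noncomputable def normF (T s : ℝ) (u : ℝ → L2) : ℝ≥0∞ :=
  shortTimeNorm normU2ZK T s (fun t => UnitAddTorus.mFourierCoeff (u t))

/-- The norm of `N^s_{ZK}(T)`. -/
noncomputable def normN (T s : ℝ) (f : ℝ → Coeffs) : ℝ≥0∞ :=
  shortTimeNorm normDU2ZK T s f

/-- The distribution `∂_x (g h)` for `g, h ∈ L²(𝕋²)`: here `g h ∈ L¹(𝕋²)`, and the `k`-th Fourier
coefficient of its distributional derivative is `i k₁` times that of `g h`. -/
noncomputable def dxMul (g h : L2) : Coeffs := fun k =>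
  Complex.I * (k 0 : ℂ) * UnitAddTorus.mFourierCoeff (fun x => g x * h x) k

end ZK

namespace ZK

/-! The windows are so short that no dispersion is needed: the propagator enters only as an isometry
of `L2`. On the block `N = 2 ^ J`, Bernstein from `L¹` to `L²` costs a factor `N` (the annulus has
`O(N²)` lattice points) and `∂_x` costs another `N`, while integrating in time over a window of
length at most `N⁻²` regains `N⁻²`.

The gain in time is `normDU2_le_of_bounded`: a function bounded by `M` has a primitive with
Lipschitz constant `M`, and Lipschitz functions lie in `U²` by 4-adic telescoping
(`normU2_le_of_lipschitz`). Since `U²` controls the supremum norm (`enorm_le_normU2`), only `L²`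
bounds at fixed times are needed for `u` and `v`.

At a fixed time, Cauchy–Schwarz bounds the coefficients of `u v` at level `J` (`enorm_conv_sq_le`).
Either `v` has level at least `J - 1`, or `u` has level within 1 of `J`. Summing over `J` with
weights (`tsum_pow_mul_convBound_le`), the second case is nearly diagonal; the first is a geometric
sum over `J ≤ l + 1`, dominated by its top term because `s > 0`.

The functions `u`, `v` are not assumed measurable in time; finiteness of the norms supplies the
measurability that `DU²` requires. -/

/-! ### Atoms and elementary properties of `U²`. -/

/-- On each cell of the partition an atom takes the value attached to that cell. -/
theorem sum_indicator_Ico_eq {K : ℕ} {t : ℕ → ℝ} (ht : ∀ k < K, t k < t (k + 1)) (φ : ℕ → L2)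
    {k : ℕ} (hk : k < K) {x : ℝ} (hx : x ∈ Ico (t k) (t (k + 1))) :
    ∑ i ∈ Finset.range K, (Ico (t i) (t (i + 1))).indicator (fun _ => φ i) x = φ k := by
  have mono : ∀ n, n ≤ K → ∀ m ≤ n, t m ≤ t n := by
    intro n
    induction n with
    | zero => intro _ m hm; rw [Nat.le_zero.1 hm]
    | succ n ih =>
      intro hn m hm
      rcases Nat.lt_or_ge m (n + 1) with h | h
      · exact (ih (by omega) m (by omega)).trans (ht n (by omega)).le
      · rw [le_antisymm hm h]
  rw [Finset.sum_eq_single k]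
  · rw [indicator_of_mem hx]
  · intro i hi hik
    have hi' := Finset.mem_range.1 hi
    refine indicator_of_notMem (fun h => ?_) _
    rcases lt_or_gt_of_ne hik with h' | h'
    · exact absurd (h.2.trans_le (mono k hk.le (i + 1) h')) (not_lt.2 hx.1)
    · exact absurd (hx.2.trans_le (mono i hi'.le (k + 1) h')) (not_lt.2 h.1)
  · intro h
    exact absurd (Finset.mem_range.2 hk) h

theorem IsAtom.norm_le {a b : ℝ} {A : ℝ → L2} (hA : IsAtom a b A) {x : ℝ} (hx : x ∈ Ico a b) :
    ‖A x‖ ≤ 1 := by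
  obtain ⟨K, t, φ, -, -, ht, hφ, hf⟩ := hA
  rw [hf x hx]
  by_cases h : ∃ k < K, x ∈ Ico (t k) (t (k + 1))
  · obtain ⟨k, hk, hxk⟩ := h
    rw [sum_indicator_Ico_eq ht φ hk hxk]
    have : ‖φ k‖ ^ 2 ≤ 1 := (Finset.single_le_sum (f := fun k => ‖φ k‖ ^ 2)
      (fun i _ => by positivity) (Finset.mem_range.2 hk)).trans hφ.le
    exact (sq_le_one_iff₀ (norm_nonneg _)).1 this
  · push Not at h
    rw [Finset.sum_eq_zero]
    · simp
    · intro i hi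
      exact indicator_of_notMem (h i (Finset.mem_range.1 hi)) _

theorem IsAtom.aestronglyMeasurable {a b : ℝ} {A : ℝ → L2} (hA : IsAtom a b A) :
    AEStronglyMeasurable A (volume.restrict (Ico a b)) := by
  obtain ⟨K, t, φ, -, -, -, -, hf⟩ := hA
  refine AEStronglyMeasurable.congr (f := fun x => ∑ k ∈ Finset.range K,
    (Ico (t k) (t (k + 1))).indicator (fun _ => φ k) x) ?_ ?_
  · refine (Finset.stronglyMeasurable_fun_sum _ fun i _ => ?_).aestronglyMeasurable
    exact stronglyMeasurable_const.indicator measurableSet_Ico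
  · exact (ae_restrict_iff' measurableSet_Ico).2 (Eventually.of_forall fun x hx => (hf x hx).symm)

/-- The `U²`-norm controls the supremum norm. -/
theorem enorm_le_normU2 {a b x : ℝ} (hx : x ∈ Ico a b) (f : ℝ → L2) :
    ‖f x‖ₑ ≤ normU2 a b f := by
  refine le_iInf fun l => le_iInf fun A => le_iInf fun hA => le_iInf fun h => ?_
  by_cases htop : ∑' n, ‖l n‖ₑ = ⊤
  · rw [htop]; exact le_top
  rw [← (h x hx).tsum_eq]
  refine enorm_tsum_le_tsum_enorm.trans (ENNReal.tsum_le_tsum fun n => ?_)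
  rw [enorm_smul]
  refine mul_le_of_le_one_right' ?_
  rw [← ofReal_norm]
  exact ENNReal.ofReal_le_one.2 ((hA n).norm_le hx)

theorem normU2_le_tsum {a b : ℝ} {f : ℝ → L2} {l : ℕ → ℂ} {A : ℕ → ℝ → L2}
    (hA : ∀ n, IsAtom a b (A n)) (h : ∀ x ∈ Ico a b, HasSum (fun n => l n • A n x) (f x)) :
    normU2 a b f ≤ ∑' n, ‖l n‖ₑ :=
  iInf₂_le_of_le l A (iInf₂_le hA h)

/-- An atomic series is a pointwise limit of step functions. This is the source of all measurability
in time. -/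
theorem aestronglyMeasurable_of_normU2_ne_top {a b : ℝ} {f : ℝ → L2} (hf : normU2 a b f ≠ ⊤) :
    AEStronglyMeasurable f (volume.restrict (Ico a b)) := by
  obtain ⟨l, A, hA, h, -⟩ : ∃ (l : ℕ → ℂ) (A : ℕ → ℝ → L2), (∀ n, IsAtom a b (A n)) ∧
      (∀ x ∈ Ico a b, HasSum (fun n => l n • A n x) (f x)) ∧ ∑' n, ‖l n‖ₑ < ⊤ := by
    have := lt_top_iff_ne_top.2 hf
    simpa only [normU2, iInf_lt_iff, exists_prop] using this
  refine aestronglyMeasurable_of_tendsto_ae atTop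
    (f := fun N x => ∑ n ∈ Finset.range N, l n • A n x) (fun N => ?_) ?_
  · exact Finset.aestronglyMeasurable_fun_sum _ fun n _ => 
      ((hA n).aestronglyMeasurable.const_smul (l n) :)
  · exact (ae_restrict_iff' measurableSet_Ico).2
      (Eventually.of_forall fun x hx => (h x hx).tendsto_sum_nat)

/-! ### Lipschitz functions in `U²`. -/

theorem exists_unit_L2 : ∃ e : L2, ‖e‖ = 1 :=
  ⟨UnitAddTorus.mFourierLp 2 0, UnitAddTorus.orthonormal_mFourier.1 0⟩

theorem exists_isAtom {a b : ℝ} (hab : a < b) : ∃ A, IsAtom a b A := by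
  obtain ⟨e, he⟩ := exists_unit_L2
  refine ⟨_, 1, fun n => if n = 0 then a else b, fun _ => e, by simp, by simp, ?_, by simp [he],
    fun x _ => rfl⟩
  intro k hk
  obtain rfl : k = 0 := by omega
  simpa using hab

/-- A step function along the uniform partition into `p` cells is a multiple of an atom. -/
theorem exists_smul_isAtom {a b : ℝ} (hab : a < b) {p : ℕ} (hp : 0 < p) (φ : ℕ → L2) {B : ℝ}
    (hB : 0 ≤ B) (hφ : ∑ k ∈ Finset.range p, ‖φ k‖ ^ 2 ≤ B ^ 2) :
    ∃ (l : ℂ) (A : ℝ → L2), IsAtom a b A ∧ ‖l‖ ≤ B ∧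
      ∀ x ∈ Ico a b, l • A x = φ ⌊p * ((x - a) / (b - a))⌋₊ := by
  have hL : 0 < b - a := sub_pos.2 hab
  have hp' : (0 : ℝ) < p := by exact_mod_cast hp
  have cell : ∀ x ∈ Ico a b, ⌊p * ((x - a) / (b - a))⌋₊ < p := by
    intro x hx
    have h1 : (x - a) / (b - a) < 1 := (div_lt_one hL).2 (by linarith [hx.2])
    have h0 : 0 ≤ (x - a) / (b - a) := div_nonneg (by linarith [hx.1]) hL.le
    rw [Nat.floor_lt (by positivity)]
    nlinarith
  set S := ∑ k ∈ Finset.range p, ‖φ k‖ ^ 2 with hS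
  have hS0 : 0 ≤ S := Finset.sum_nonneg fun _ _ => by positivity
  rcases hS0.eq_or_lt with h0 | hpos
  -- The zero step function cannot be normalized to an atom, so any atom is taken with coefficient
  -- zero.
  · obtain ⟨A, hA⟩ := exists_isAtom hab
    refine ⟨0, A, hA, by simpa using hB, fun x hx => ?_⟩
    have := (Finset.sum_eq_zero_iff_of_nonneg (fun i _ => by positivity)).1 h0.symm _
      (Finset.mem_range.2 (cell x hx))
    rw [zero_smul]
    exact (norm_eq_zero.1 (pow_eq_zero_iff two_ne_zero |>.1 this)).symm
  · set c := Real.sqrt S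
    have hc : 0 < c := Real.sqrt_pos.2 hpos
    have hcS : c ^ 2 = S := Real.sq_sqrt hS0
    have hc' : (c : ℂ) ≠ 0 := by exact_mod_cast hc.ne'
    set t : ℕ → ℝ := fun k => a + k * ((b - a) / p) with ht
    set ψ : ℕ → L2 := fun k => (c : ℂ)⁻¹ • φ k with hψ
    have hstep : ∀ k < p, t k < t (k + 1) := by
      intro k _
      have : 0 < (b - a) / p := by positivity
      simp only [ht]; push_cast; linarith
    refine ⟨c, fun x => ∑ k ∈ Finset.range p, (Ico (t k) (t (k + 1))).indicator (fun _ => ψ k) x,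
      ⟨p, t, ψ, by simp [ht], ?_, hstep, ?_, fun _ _ => rfl⟩, ?_, fun x hx => ?_⟩
    · simp only [ht]; field_simp; ring
    · have : ∀ k, ‖ψ k‖ ^ 2 = S⁻¹ * ‖φ k‖ ^ 2 := by
        intro k
        rw [hψ, norm_smul, norm_inv, Complex.norm_real, Real.norm_of_nonneg hc.le, mul_pow,
          inv_pow, hcS]
      simp_rw [this, ← Finset.mul_sum, ← hS]
      exact inv_mul_cancel₀ hpos.ne'
    · rw [Complex.norm_real, Real.norm_of_nonneg hc.le]
      exact abs_le_of_sq_le_sq' (hcS ▸ hφ) hB |>.2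
    · have h0 : 0 ≤ p * ((x - a) / (b - a)) :=
        mul_nonneg hp'.le (div_nonneg (by linarith [hx.1]) hL.le)
      have e : x = a + p * ((x - a) / (b - a)) * ((b - a) / p) := by field_simp; ring
      have hq : 0 < (b - a) / p := by positivity
      beta_reduce
      rw [sum_indicator_Ico_eq hstep ψ (cell x hx), hψ, smul_smul, mul_inv_cancel₀ hc', one_smul]
      refine ⟨?_, ?_⟩
      · conv_rhs => rw [e]
        simp only [ht]
        gcongr
        exact Nat.floor_le h0
      · conv_lhs => rw [e]
        simp only [ht]
        gcongr
        push_cast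
        exact Nat.lt_floor_add_one _

/-- Lipschitz functions belong to `U²`. -/
theorem normU2_le_of_lipschitz {a b M : ℝ} (hab : a < b) (hM : 0 ≤ M) {w : ℝ → L2} (hb : w b = 0)
    (hw : ∀ x y, ‖w x - w y‖ ≤ M * |x - y|) :
    normU2 a b w ≤ ENNReal.ofReal (8 * (M * (b - a))) := by
  have hL : 0 < b - a := sub_pos.2 hab
  set R := M * (b - a) with hR
  have hR0 : 0 ≤ R := by positivity
  -- Left endpoints of the 4-adic cells of generation `n`. The parent of cell `k` is cell `k / 4`,
  -- so the `φ n` below are the increments of the telescoping sum for `w`.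
  let q : ℕ → ℕ → ℝ := fun n k => a + k * ((b - a) / 4 ^ n)
  let φ : ℕ → ℕ → L2 := fun n => match n with
    | 0 => fun _ => w a
    | n + 1 => fun k => w (q (n + 1) k) - w (q n (k / 4))
  have hφ : ∀ n k, ‖φ n k‖ ≤ 4 * R * (1 / 4) ^ n := by
    intro n k
    cases n with
    | zero =>
      have := hw a b
      rw [hb, sub_zero, abs_of_neg (by linarith)] at this
      simp only [φ]
      nlinarith
    | succ n =>
      refine (hw _ _).trans ?_
      have h1 : |q (n + 1) k - q n (k / 4)| ≤ (b - a) / 4 ^ n := by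
        have hd : (0 : ℝ) < (b - a) / 4 ^ n := by positivity
        have e1 : (4 * (k / 4 : ℕ) + (k % 4 : ℕ) : ℝ) = k := by exact_mod_cast Nat.div_add_mod k 4
        have e2 : ((k % 4 : ℕ) : ℝ) ≤ 4 := by exact_mod_cast (Nat.mod_lt k (by norm_num)).le
        have e3 : (0 : ℝ) ≤ (k % 4 : ℕ) := by positivity
        have : q (n + 1) k - q n (k / 4) = (k % 4 : ℕ) / 4 * ((b - a) / 4 ^ n) := by
          simp only [q]
          rw [pow_succ, ← e1]
          field_simp
          ring
        rw [this, abs_of_nonneg (by positivity)]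
        exact mul_le_of_le_one_left hd.le (by linarith)
      calc M * |q (n + 1) k - q n (k / 4)| ≤ M * ((b - a) / 4 ^ n) := by gcongr
        _ = 4 * R * (1 / 4) ^ (n + 1) := by
          rw [hR, pow_succ, div_pow, one_pow]; field_simp
  have hstep : ∀ n, ∃ (l : ℂ) (A : ℝ → L2), IsAtom a b A ∧ ‖l‖ ≤ 4 * R * (1 / 2) ^ n ∧
      ∀ x ∈ Ico a b, l • A x = φ n ⌊(4 ^ n : ℕ) * ((x - a) / (b - a))⌋₊ := by
    intro n
    refine exists_smul_isAtom hab (by positivity) (φ n) (by positivity) ?_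
    -- There are `4 ^ n` increments of size `4 * R * 4⁻ⁿ`, so their `ℓ²` norm is `4 * R * 2⁻ⁿ`,
    -- which sums to `8 * R`.
    calc ∑ k ∈ Finset.range (4 ^ n), ‖φ n k‖ ^ 2
        ≤ ∑ k ∈ Finset.range (4 ^ n), (4 * R * (1 / 4) ^ n) ^ 2 := by
          gcongr with k _
          exact hφ n k
      _ = (4 * R * (1 / 2) ^ n) ^ 2 := by
          rw [Finset.sum_const, Finset.card_range, nsmul_eq_mul]
          push_cast
          rw [mul_pow, mul_pow (4 * R), ← pow_mul, ← pow_mul, mul_comm n 2, pow_mul, pow_mul,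
            mul_left_comm, ← mul_pow]
          norm_num
  choose l A hA hl hlA using hstep
  refine (normU2_le_tsum (l := l) hA ?_).trans ?_
  · intro x hx
    have hx0 : 0 ≤ (x - a) / (b - a) := div_nonneg (by linarith [hx.1]) hL.le
    have hx1 : (x - a) / (b - a) < 1 := (div_lt_one hL).2 (by linarith [hx.2])
    set y := (x - a) / (b - a) with hy
    let z : ℕ → ℝ := fun n => q n ⌊(4 ^ n : ℕ) * y⌋₊
    have hsum : ∀ n, ∑ i ∈ Finset.range (n + 1), l i • A i x = w (z n) := by
      intro n
      induction n with
      | zero =>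
        rw [Finset.sum_range_one, hlA 0 x hx]
        have : ⌊y⌋₊ = 0 := Nat.floor_eq_zero.2 hx1
        simp [φ, z, q, this]
      | succ n ih =>
        rw [Finset.sum_range_succ, ih, hlA (n + 1) x hx]
        have : ⌊(4 ^ (n + 1) : ℕ) * y⌋₊ / 4 = ⌊(4 ^ n : ℕ) * y⌋₊ := by
          have := Nat.floor_div_natCast (((4 ^ (n + 1) : ℕ) : ℝ) * y) 4
          rw [← this]
          congr 1
          push_cast
          rw [pow_succ]
          ring
        simp only [φ, z]
        rw [this]
        abel
    have hz : Tendsto z atTop (𝓝 x) := by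
      rw [tendsto_iff_dist_tendsto_zero]
      have hlim : Tendsto (fun n : ℕ => (b - a) * (1 / 4 : ℝ) ^ n) atTop (𝓝 0) := by
        simpa using (tendsto_pow_atTop_nhds_zero_of_lt_one (r := (1 / 4 : ℝ)) (by norm_num)
          (by norm_num)).const_mul (b - a)
      refine squeeze_zero (fun _ => dist_nonneg) (fun n => ?_) hlim
      have h4 : (0 : ℝ) < 4 ^ n := by positivity
      have e : x = a + (4 ^ n * y) * ((b - a) / 4 ^ n) := by rw [hy]; field_simp; ring
      have f1 : (⌊(4 ^ n : ℝ) * y⌋₊ : ℝ) ≤ 4 ^ n * y := Nat.floor_le (by positivity)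
      have f2 : (4 ^ n : ℝ) * y < ⌊(4 ^ n : ℝ) * y⌋₊ + 1 := Nat.lt_floor_add_one _
      rw [dist_comm, Real.dist_eq]
      have : x - z n = (4 ^ n * y - ⌊(4 ^ n : ℝ) * y⌋₊) * ((b - a) / 4 ^ n) := by
        conv_lhs => rw [e]
        simp only [z, q]
        push_cast
        ring
      rw [this, abs_of_nonneg (mul_nonneg (by linarith) (by positivity))]
      calc _ ≤ 1 * ((b - a) / 4 ^ n) := by gcongr; linarith
        _ = _ := by rw [div_pow, one_pow]; ring
    have hwc : Tendsto (fun n => w (z n)) atTop (𝓝 (w x)) := by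
      rw [tendsto_iff_norm_sub_tendsto_zero]
      have := ((tendsto_iff_dist_tendsto_zero.1 hz).const_mul M)
      rw [mul_zero] at this
      exact squeeze_zero (fun _ => norm_nonneg _) (fun n => hw _ _) this
    have hsm : Summable fun n => l n • A n x := by
      refine Summable.of_norm_bounded (g := fun n => 4 * R * (1 / 2 : ℝ) ^ n)
        (summable_geometric_two.mul_left _) fun n => ?_
      rw [norm_smul]
      exact (mul_le_of_le_one_right (norm_nonneg _) ((hA n).norm_le hx)).trans (hl n)
    rw [hsm.hasSum_iff_tendsto_nat, ← tendsto_add_atTop_iff_nat 1]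
    simpa only [hsum] using hwc
  · have hs : HasSum (fun n : ℕ => 4 * R * (1 / 2 : ℝ) ^ n) (8 * R) := by
      rw [show 8 * R = 4 * R * 2 by ring]
      exact hasSum_geometric_two.mul_left (4 * R)
    rw [← hs.tsum_eq, ENNReal.ofReal_tsum_of_nonneg (fun n => by positivity) hs.summable]
    refine ENNReal.tsum_le_tsum fun n => ?_
    rw [← ofReal_norm]
    exact ENNReal.ofReal_le_ofReal (hl n)

/-! ### Weak primitives and bounded functions in `DU²`. -/

/-- The primitive `x ↦ -∫_x^∞ F` of an integrable function is a weak primitive. -/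
theorem integral_deriv_smul_neg_integral_Ioi {F : ℝ → L2} (hF : Integrable F) {ψ : ℝ → ℂ}
    (hψ : ContDiff ℝ ∞ ψ) (hc : HasCompactSupport ψ) :
    ∫ x, deriv ψ x • (-∫ y in Ioi x, F y) = -∫ x, ψ x • F x := by
  have hψ1 : ContDiff ℝ 1 ψ := hψ.of_le (by exact_mod_cast le_top)
  have hd : Integrable (deriv ψ) :=
    (hψ1.continuous_deriv le_rfl).integrable_of_hasCompactSupport hc.deriv
  have hprod : Integrable (fun z : ℝ × ℝ => deriv ψ z.1 • F z.2) (volume.prod volume) :=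
    hd.smul_prod hF
  -- Integrability on the half-plane `x < y`, for Fubini; the inner integral of `deriv ψ` over `x <
  -- y` then gives back `ψ y`.
  have hind : Integrable (Function.uncurry fun x y : ℝ =>
      (Ioi x).indicator (fun y => deriv ψ x • F y) y) (volume.prod volume) := by
    refine (hprod.indicator (measurableSet_lt measurable_fst measurable_snd)).congr
      (Eventually.of_forall fun z => ?_)
    simp [Function.uncurry, indicator]
  simp_rw [smul_neg, integral_neg]
  congr 1
  calc ∫ x, deriv ψ x • ∫ y in Ioi x, F y
      = ∫ x, ∫ y, (Ioi x).indicator (fun y => deriv ψ x • F y) y := by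
        refine integral_congr_ae (Eventually.of_forall fun x => ?_)
        beta_reduce
        rw [integral_indicator measurableSet_Ioi, integral_smul]
    _ = ∫ y, ∫ x, (Ioi x).indicator (fun y => deriv ψ x • F y) y := integral_integral_swap hind
    _ = ∫ y, ψ y • F y := by
        refine integral_congr_ae (Eventually.of_forall fun y => ?_)
        beta_reduce
        have : ∀ x, (Ioi x).indicator (fun y => deriv ψ x • F y) y =
            (Iio y).indicator (fun x => deriv ψ x • F y) x := by
          intro x
          simp [indicator]
        simp_rw [this]
        rw [integral_indicator measurableSet_Iio, integral_smul_const, ← integral_Iic_eq_integral_Iio,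
          hc.integral_Iic_deriv_eq hψ1]

/-- Bounded measurable functions belong to `DU²`. -/
theorem normDU2_le_of_bounded {a b M : ℝ} (hab : a < b) (hM : 0 ≤ M) {f : ℝ → L2}
    (hf : AEStronglyMeasurable f (volume.restrict (Ico a b))) (hfM : ∀ x ∈ Ico a b, ‖f x‖ ≤ M) :
    normDU2 a b f ≤ ENNReal.ofReal (8 * (M * (b - a))) := by
  -- Extension by zero makes the primitive globally Lipschitz and zero at `b`.
  set F : ℝ → L2 := (Ico a b).indicator f with hFdef
  have hFM : ∀ x, ‖F x‖ ≤ M := by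
    intro x
    by_cases hx : x ∈ Ico a b
    · rw [hFdef, indicator_of_mem hx]; exact hfM x hx
    · rw [hFdef, indicator_of_notMem hx, norm_zero]; exact hM
  have hfi : IntegrableOn f (Ico a b) :=
    Integrable.of_bound hf M
      ((ae_restrict_iff' measurableSet_Ico).2 (Eventually.of_forall hfM))
  have hF : Integrable F := hfi.integrable_indicator measurableSet_Ico
  set w : ℝ → L2 := fun x => -∫ y in Ioi x, F y with hw
  have hwsub : ∀ x y, w x - w y = ∫ z in y..x, F z := by
    intro x y
    have := intervalIntegral.integral_Ioi_sub_Ioi' (a := y) (b := x) (μ := volume)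
      hF.integrableOn hF.integrableOn
    rw [← this, hw]
    beta_reduce
    abel
  have hlip : ∀ x y, ‖w x - w y‖ ≤ M * |x - y| := by
    intro x y
    rw [hwsub]
    exact intervalIntegral.norm_integral_le_of_norm_le_const fun z _ => hFM z
  have hwb : w b = 0 := by
    rw [hw]
    beta_reduce
    rw [setIntegral_eq_zero_of_forall_eq_zero, neg_zero]
    intro x hx
    exact indicator_of_notMem (fun h => absurd h.2 (not_lt.2 (le_of_lt hx))) _
  have hwc : Continuous w := by
    refine (LipschitzWith.of_dist_le_mul (K := ⟨M, hM⟩) fun x y => ?_).continuous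
    rw [dist_eq_norm, Real.dist_eq]
    exact hlip x y
  refine (iInf₂_le_of_le w ?_ (iInf_le _ ?_)).trans (normU2_le_of_lipschitz hab hM hwb hlip)
  · have := hwc.tendsto b
    rw [hwb] at this
    exact this.mono_left nhdsWithin_le_nhds
  · refine ⟨hwc.locallyIntegrable.locallyIntegrableOn _,
      (hfi.mono_set Ioo_subset_Ico_self).locallyIntegrableOn, fun ψ hψ hc hs => ?_⟩
    rw [integral_deriv_smul_neg_integral_Ioi hF hψ hc]
    congr 2
    funext x
    by_cases hx : x ∈ Ico a b
    · rw [hFdef, indicator_of_mem hx]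
    · rw [image_eq_zero_of_notMem_tsupport fun h => hx (Ioo_subset_Ico_self (hs h)), zero_smul,
        zero_smul]

/-! ### Fourier coefficients of propagators, projections and products. -/

theorem repr_propagator (t : ℝ) (f : L2) (k : Fin 2 → ℤ) :
    UnitAddTorus.mFourierBasis.repr (propagator t f) k =
      Complex.exp (Complex.I * ((t * phase k : ℝ) : ℂ)) * UnitAddTorus.mFourierBasis.repr f k := by
  rw [propagator, LinearIsometryEquiv.apply_symm_apply]

theorem norm_propagator (t : ℝ) (f : L2) : ‖propagator t f‖ = ‖f‖ := by
  rw [← UnitAddTorus.mFourierBasis.repr.norm_map (propagator t f),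
    ← UnitAddTorus.mFourierBasis.repr.norm_map f, lp.norm_eq_tsum_rpow (by simp),
    lp.norm_eq_tsum_rpow (by simp)]
  simp_rw [repr_propagator, norm_mul, mul_comm Complex.I, Complex.norm_exp_ofReal_mul_I, one_mul]

theorem repr_lpProj (j : ℕ) (c : Coeffs) (k : Fin 2 → ℤ) :
    UnitAddTorus.mFourierBasis.repr (lpProj j c) k = (annulus j).indicator c k := by
  classical
  rw [HilbertBasis.repr_apply_apply, lpProj, inner_sum, UnitAddTorus.coe_mFourierBasis]
  simp_rw [inner_smul_right, orthonormal_iff_ite.1 UnitAddTorus.orthonormal_mFourier]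
  simp [indicator]

theorem enorm_lpProj_sq (j : ℕ) (c : Coeffs) :
    ‖lpProj j c‖ₑ ^ 2 = ∑ k ∈ (annulus_finite j).toFinset, ‖c k‖ₑ ^ 2 := by
  have h : ‖lpProj j c‖ ^ 2 = ∑ k ∈ (annulus_finite j).toFinset, ‖c k‖ ^ 2 := by
    have := UnitAddTorus.orthonormal_mFourier.inner_sum (𝕜 := ℂ) c c (annulus_finite j).toFinset
    have h2 := inner_self_eq_norm_sq_to_K (𝕜 := ℂ) (lpProj j c)
    rw [lpProj, this] at h2
    simp_rw [RCLike.conj_mul] at h2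
    exact_mod_cast h2.symm
  simp_rw [← ofReal_norm, ← ENNReal.ofReal_pow (norm_nonneg _)]
  rw [h, ENNReal.ofReal_sum_of_nonneg fun _ _ => by positivity]

/-- Parseval for the pair `e_k · conj g` and `h`: conjugating the `m`-th coefficient of the first
gives the coefficient of `g` at `k - m`. -/
theorem hasSum_mFourierCoeff_mul (g h : L2) (k : Fin 2 → ℤ) :
    HasSum (fun m => UnitAddTorus.mFourierCoeff g (k - m) * UnitAddTorus.mFourierCoeff h m)
      (UnitAddTorus.mFourierCoeff (fun x => g x * h x) k) := by
  have hmem : MemLp (fun x => UnitAddTorus.mFourier k x * (starRingEnd ℂ) (g x)) 2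
      (Measure.pi (fun _ : Fin 2 => (AddCircle.haarAddCircle : Measure UnitAddCircle))) := by
    refine (Lp.memLp g).of_le ?_ (Eventually.of_forall fun x => ?_)
    · exact (UnitAddTorus.mFourier k).continuous.aestronglyMeasurable.mul
        (Complex.continuous_conj.comp_aestronglyMeasurable (Lp.aestronglyMeasurable g))
    · rw [norm_mul, RCLike.norm_conj]
      refine mul_le_of_le_one_left (norm_nonneg _) ?_
      exact ((UnitAddTorus.mFourier k).norm_coe_le_norm x).trans UnitAddTorus.mFourier_norm.le
  have hX := hmem.coeFn_toLp
  have key := UnitAddTorus.hasSum_prod_mFourierCoeff (hmem.toLp _) h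
  have e : ∀ m, (starRingEnd ℂ) (UnitAddTorus.mFourierCoeff (hmem.toLp _) m) =
      UnitAddTorus.mFourierCoeff g (k - m) := by
    intro m
    rw [UnitAddTorus.mFourierCoeff, UnitAddTorus.mFourierCoeff, ← integral_conj]
    refine integral_congr_ae ?_
    filter_upwards [hX] with x hx
    rw [hx, neg_sub, sub_eq_add_neg, UnitAddTorus.mFourier_add]
    simp only [smul_eq_mul, map_mul, Complex.conj_conj, UnitAddTorus.mFourier_neg]
    ring
  simp_rw [e] at key
  convert key using 1
  rw [UnitAddTorus.mFourierCoeff]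
  refine integral_congr_ae ?_
  filter_upwards [hX] with x hx
  rw [hx]
  simp only [smul_eq_mul, map_mul, Complex.conj_conj, UnitAddTorus.mFourier_neg]
  ring

/-! ### Dyadic frequency levels and convolution. -/

theorem freqNorm_add_le (m n : Fin 2 → ℤ) : freqNorm (m + n) ≤ freqNorm m + freqNorm n := by
  have e : ∀ k : Fin 2 → ℤ, freqNorm k = ‖((k 0 : ℝ) : ℂ) + ((k 1 : ℝ) : ℂ) * Complex.I‖ :=
    fun k => (Complex.norm_add_mul_I _ _).symm
  rw [e, e, e]
  refine (le_of_eq ?_).trans (norm_add_le _ _)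
  congr 1
  simp only [Pi.add_apply]
  push_cast
  ring

theorem freqNorm_neg (m : Fin 2 → ℤ) : freqNorm (-m) = freqNorm m := by
  simp [freqNorm]

theorem exists_mem_annulus (k : Fin 2 → ℤ) : ∃ j, k ∈ annulus j := by
  rcases lt_or_ge (freqNorm k) 2 with h | h
  · exact ⟨0, by simpa using h, Or.inl rfl⟩
  · obtain ⟨n, h1, h2⟩ := exists_nat_pow_near (y := (2 : ℝ)) (by linarith : 1 ≤ freqNorm k)
      one_lt_two
    exact ⟨n, h2, Or.inr h1⟩

/-- If `k = (k - m) + m` has level `J` and `m` has level at most `J - 2`, then `k - m` has level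
`J - 1`, `J` or `J + 1`. -/
theorem level_sub_of_low {k m : Fin 2 → ℤ} {J j l : ℕ} (hk : k ∈ annulus J) (hm : m ∈ annulus l)
    (hl : l + 2 ≤ J) (hj : k - m ∈ annulus j) : j ≤ J + 1 ∧ J ≤ j + 1 := by
  obtain ⟨I, rfl⟩ : ∃ I, J = I + 2 := ⟨J - 2, by omega⟩
  have hm1 : freqNorm m < 2 ^ (I + 1) :=
    hm.1.trans_le (pow_le_pow_right₀ one_le_two (by omega))
  have hk0 : (2 : ℝ) ^ (I + 2) ≤ freqNorm k := hk.2.resolve_left (by omega)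
  have hk1 := hk.1
  have h1 := freqNorm_add_le (k - m) m
  have h2 := freqNorm_add_le k (-m)
  rw [sub_add_cancel] at h1
  rw [freqNorm_neg, ← sub_eq_add_neg] at h2
  have hp : (0 : ℝ) < 2 ^ I := by positivity
  simp only [pow_succ] at hk0 hk1 hm1
  constructor
  · by_contra hcon
    have hj0 : (2 : ℝ) ^ j ≤ freqNorm (k - m) := hj.2.resolve_left (by omega)
    have : (2 : ℝ) ^ (I + 4) ≤ 2 ^ j := pow_le_pow_right₀ one_le_two (by omega)
    simp only [pow_succ] at this
    linarith
  · by_contra hcon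
    have hj1 := hj.1
    have : (2 : ℝ) ^ (j + 1) ≤ 2 ^ (I + 1) := pow_le_pow_right₀ one_le_two (by omega)
    simp only [pow_succ] at this hj1
    linarith

theorem tsum_indicator_le_tsum_annulus (F : (Fin 2 → ℤ) → ℝ≥0∞) {P : Set ℕ}
    {S : Set (Fin 2 → ℤ)} (hS : ∀ m ∈ S, ∃ j ∈ P, m ∈ annulus j) :
    ∑' m, S.indicator F m ≤
      ∑' j, P.indicator (fun j => ∑ m ∈ (annulus_finite j).toFinset, F m) j := by
  classical
  calc ∑' m, S.indicator F m
      ≤ ∑' m, ∑' j, P.indicator (fun j => (annulus j).indicator F m) j := by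
        refine ENNReal.tsum_le_tsum fun m => ?_
        by_cases hm : m ∈ S
        · obtain ⟨j, hj, hmj⟩ := hS m hm
          refine le_trans ?_ (ENNReal.le_tsum j)
          rw [indicator_of_mem hm, indicator_of_mem hj, indicator_of_mem hmj]
        · rw [indicator_of_notMem hm]; exact zero_le
    _ = ∑' j, ∑' m, P.indicator (fun j => (annulus j).indicator F m) j := ENNReal.tsum_comm
    _ = _ := by
        refine tsum_congr fun j => ?_
        by_cases hj : j ∈ P
        · simp only [indicator_of_mem hj]
          rw [tsum_eq_sum (s := (annulus_finite j).toFinset)]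
          · refine Finset.sum_congr rfl fun m hm => ?_
            rw [indicator_of_mem ((annulus_finite j).mem_toFinset.1 hm)]
          · intro m hm
            exact indicator_of_notMem (fun h => hm ((annulus_finite j).mem_toFinset.2 h)) _
        · simp [indicator_of_notMem hj]

theorem sq_tsum_mul_le {ι : Type*} (f g : ι → ℝ≥0∞) :
    (∑' i, f i * g i) ^ 2 ≤ (∑' i, f i ^ 2) * ∑' i, g i ^ 2 := by
  have h : ∑' i, f i * g i ≤ (∑' i, f i ^ 2) ^ (1 / 2 : ℝ) * (∑' i, g i ^ 2) ^ (1 / 2 : ℝ) := by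
    rw [ENNReal.tsum_eq_iSup_sum]
    refine iSup_le fun s => ?_
    refine (ENNReal.inner_le_Lp_mul_Lq s f g Real.HolderConjugate.two_two).trans ?_
    simp only [ENNReal.rpow_two]
    gcongr <;> exact ENNReal.sum_le_tsum s
  calc (∑' i, f i * g i) ^ 2
      ≤ ((∑' i, f i ^ 2) ^ (1 / 2 : ℝ) * (∑' i, g i ^ 2) ^ (1 / 2 : ℝ)) ^ 2 := by gcongr
    _ = _ := by
      rw [mul_pow, ← ENNReal.rpow_two, ← ENNReal.rpow_two, ← ENNReal.rpow_mul, ← ENNReal.rpow_mul]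
      norm_num

theorem ennreal_add_sq_le (x y : ℝ≥0∞) : (x + y) ^ 2 ≤ 2 * (x ^ 2 + y ^ 2) := by
  have := ENNReal.rpow_add_le_mul_rpow_add_rpow x y (p := 2) (by norm_num)
  norm_num at this
  exact this

/-- Bilinear bound for the convolution of two sequences at a frequency of level `J`, in terms of
the energies of the sequences on the annuli. -/
theorem enorm_conv_sq_le {a b : Coeffs} {c : ℂ} {k : Fin 2 → ℤ} {J : ℕ} (hk : k ∈ annulus J)
    (hc : HasSum (fun m => a (k - m) * b m) c) {α β : ℕ → ℝ≥0∞}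
    (hα : ∀ j, ∑ m ∈ (annulus_finite j).toFinset, ‖a m‖ₑ ^ 2 ≤ α j)
    (hβ : ∀ j, ∑ m ∈ (annulus_finite j).toFinset, ‖b m‖ₑ ^ 2 ≤ β j) :
    ‖c‖ₑ ^ 2 ≤ 2 * ((∑' j, α j) * ∑' l, {l | J ≤ l + 1}.indicator β l +
      (∑' j, {j | j ≤ J + 1 ∧ J ≤ j + 1}.indicator α j) * ∑' l, β l) := by
  classical
  -- `H` holds the `m` of high level. For `m` outside `H`, `level_sub_of_low` puts `k - m` in `L`,
  -- so each term of the convolution falls into one of two sums, each treated by Cauchy–Schwarz.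
  set H : Set (Fin 2 → ℤ) := {m | ∃ l ∈ {l | J ≤ l + 1}, m ∈ annulus l} with hH
  set L : Set (Fin 2 → ℤ) := {m | ∃ j ∈ {j | j ≤ J + 1 ∧ J ≤ j + 1}, m ∈ annulus j} with hL
  have energy : ∀ {e : Coeffs} {ε : ℕ → ℝ≥0∞},
      (∀ j, ∑ m ∈ (annulus_finite j).toFinset, ‖e m‖ₑ ^ 2 ≤ ε j) → ∀ (P : Set ℕ)
      (S : Set (Fin 2 → ℤ)), (∀ m ∈ S, ∃ j ∈ P, m ∈ annulus j) →
      ∑' m, (S.indicator (fun m => ‖e m‖ₑ) m) ^ 2 ≤ ∑' j, P.indicator ε j := by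
    intro e ε he P S hS
    refine le_trans (le_of_eq ?_) ((tsum_indicator_le_tsum_annulus (fun m => ‖e m‖ₑ ^ 2) hS).trans
      (ENNReal.tsum_le_tsum fun j => indicator_le_indicator (he j)))
    refine tsum_congr fun m => ?_
    by_cases hm : m ∈ S <;> simp [hm]
  have energy_univ : ∀ {e : Coeffs} {ε : ℕ → ℝ≥0∞},
      (∀ j, ∑ m ∈ (annulus_finite j).toFinset, ‖e m‖ₑ ^ 2 ≤ ε j) →
      ∑' m, ‖e m‖ₑ ^ 2 ≤ ∑' j, ε j := by
    intro e ε he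
    have := energy he univ univ fun m _ => by simpa using exists_mem_annulus m
    simpa only [indicator_univ] using this
  have split : ‖c‖ₑ ≤ ∑' m, ‖a (k - m)‖ₑ * H.indicator (fun m => ‖b m‖ₑ) m +
      ∑' m, L.indicator (fun m => ‖a m‖ₑ) (k - m) * ‖b m‖ₑ := by
    rw [← hc.tsum_eq, ← ENNReal.tsum_add]
    refine enorm_tsum_le_tsum_enorm.trans (ENNReal.tsum_le_tsum fun m => ?_)
    rw [enorm_mul]
    by_cases hm : m ∈ H
    · rw [indicator_of_mem hm]; exact le_self_add
    · have : k - m ∈ L := by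
        obtain ⟨l, hl⟩ := exists_mem_annulus m
        obtain ⟨j, hj⟩ := exists_mem_annulus (k - m)
        have hlJ : ¬ J ≤ l + 1 := fun h => hm ⟨l, h, hl⟩
        exact ⟨j, level_sub_of_low hk hl (by omega) hj, hj⟩
      rw [indicator_of_mem this]
      exact le_add_self
  have shift : ∀ F : (Fin 2 → ℤ) → ℝ≥0∞, ∑' m, F (k - m) = ∑' m, F m :=
    fun F => (Equiv.subLeft k).tsum_eq F
  calc ‖c‖ₑ ^ 2 ≤ _ := pow_le_pow_left' split 2
    _ ≤ _ := ennreal_add_sq_le _ _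
    _ ≤ _ := by
      gcongr
      · refine (sq_tsum_mul_le _ _).trans ?_
        rw [shift fun m => ‖a m‖ₑ ^ 2]
        gcongr
        · exact energy_univ hα
        · exact energy hβ _ _ fun m hm => hm
      · refine (sq_tsum_mul_le _ _).trans ?_
        rw [shift fun m => (L.indicator (fun m => ‖a m‖ₑ) m) ^ 2]
        gcongr
        · exact energy hα _ _ fun m hm => hm
        · exact energy_univ hβ

/-! ### Bernstein's inequality on an annulus. -/

theorem card_annulus_le (j : ℕ) : ((annulus_finite j).toFinset.card : ℝ≥0∞) ≤ 25 * 4 ^ j := by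
  have hsub : (annulus_finite j).toFinset ⊆
      Finset.Icc (fun _ : Fin 2 => -(2 : ℤ) ^ (j + 1)) (fun _ => (2 : ℤ) ^ (j + 1)) := by
    intro k hk
    have hk := ((annulus_finite j).mem_toFinset.1 hk).1
    have key : ∀ i, |(k i : ℝ)| ≤ 2 ^ (j + 1) := by
      intro i
      refine le_trans (Real.abs_le_sqrt ?_) hk.le
      fin_cases i
      · simpa using sq_nonneg (k 1 : ℝ)
      · simpa using sq_nonneg (k 0 : ℝ)
    rw [Finset.mem_Icc]
    refine ⟨fun i => ?_, fun i => ?_⟩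
    · exact_mod_cast (abs_le.1 (key i)).1
    · exact_mod_cast (abs_le.1 (key i)).2
  have h := Finset.card_le_card hsub
  rw [Pi.card_Icc] at h
  simp only [Int.card_Icc, Finset.prod_const, Finset.card_univ, Fintype.card_fin] at h
  -- The enclosing square has side `4 * 2 ^ j + 1 ≤ 5 * 2 ^ j`.
  have h2 : ((2 : ℤ) ^ (j + 1) + 1 - -2 ^ (j + 1)).toNat ≤ 5 * 2 ^ j := by
    have : (1 : ℤ) ≤ 2 ^ j := one_le_pow₀ (by norm_num)
    rw [Int.toNat_le]
    push_cast
    rw [pow_succ]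
    linarith
  have h3 : (annulus_finite j).toFinset.card ≤ 25 * 4 ^ j := by
    refine h.trans ((Nat.pow_le_pow_left h2 2).trans (le_of_eq ?_))
    rw [mul_pow, ← pow_mul, mul_comm j 2, pow_mul]
    norm_num
  exact_mod_cast h3

/-- Bernstein with a derivative: at most `25 * 4 ^ J` frequencies, each with `|k₁|² ≤ 4 * 4 ^ J`. -/
theorem enorm_lpProj_dxMul_sq_le {g h : L2} {J : ℕ} {Q : ℝ≥0∞}
    (hQ : ∀ k ∈ annulus J, ‖UnitAddTorus.mFourierCoeff (fun x => g x * h x) k‖ₑ ^ 2 ≤ Q) :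
    ‖lpProj J (dxMul g h)‖ₑ ^ 2 ≤ 100 * 16 ^ J * Q := by
  rw [enorm_lpProj_sq]
  have hterm : ∀ k ∈ (annulus_finite J).toFinset, ‖dxMul g h k‖ₑ ^ 2 ≤ 4 * 4 ^ J * Q := by
    intro k hk
    have hk := (annulus_finite J).mem_toFinset.1 hk
    have h0 : ‖(k 0 : ℂ)‖ₑ ≤ 2 * 2 ^ J := by
      have : |(k 0 : ℝ)| ≤ 2 ^ (J + 1) := by
        refine le_trans (Real.abs_le_sqrt ?_) hk.1.le
        simpa using sq_nonneg (k 1 : ℝ)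
      rw [← ofReal_norm, Complex.norm_intCast]
      refine (ENNReal.ofReal_le_ofReal this).trans (le_of_eq ?_)
      rw [ENNReal.ofReal_pow (by norm_num), pow_succ, mul_comm]
      norm_num
    rw [dxMul, enorm_mul, enorm_mul, mul_pow, mul_pow]
    calc ‖Complex.I‖ₑ ^ 2 * ‖(k 0 : ℂ)‖ₑ ^ 2 * _ ≤ 1 ^ 2 * (2 * 2 ^ J) ^ 2 * Q := by
          gcongr
          · rw [← ofReal_norm, Complex.norm_I, ENNReal.ofReal_one]
          · exact hQ k hk
      _ = 4 * 4 ^ J * Q := by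
          rw [mul_pow, ← pow_mul, mul_comm J 2, pow_mul]
          norm_num
  refine (Finset.sum_le_card_nsmul _ _ _ hterm).trans ?_
  rw [nsmul_eq_mul]
  calc _ ≤ 25 * 4 ^ J * (4 * 4 ^ J * Q) := by gcongr; exact card_annulus_le J
    _ = 100 * (4 * 4) ^ J * Q := by rw [mul_pow]; ring
    _ = _ := by norm_num

/-! ### Block norms: control at fixed times and measurability. -/

/-- The contribution `sup_I ‖P_N u‖_{U²_φ(I)}`, `N = 2 ^ j`, of a Littlewood–Paley block to the
norm of `F^s_{ZK}(T)`. -/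
noncomputable def blockNorm (T : ℝ) (u : ℝ → L2) (j : ℕ) : ℝ≥0∞ :=
  ⨆ (a : ℝ) (_ : 0 ≤ a) (_ : a + window T j ≤ T),
    normU2ZK a (a + window T j) (fun t => lpProj j (UnitAddTorus.mFourierCoeff (u t)))

theorem window_pos {T : ℝ} (hT : 0 < T) (j : ℕ) : 0 < window T j :=
  lt_min (by positivity) hT

theorem window_le (T : ℝ) (j : ℕ) : window T j ≤ T := min_le_right _ _

theorem normU2ZK_le_blockNorm {T a : ℝ} {j : ℕ} (u : ℝ → L2) (ha : 0 ≤ a)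
    (haT : a + window T j ≤ T) :
    normU2ZK a (a + window T j) (fun t => lpProj j (UnitAddTorus.mFourierCoeff (u t))) ≤
      blockNorm T u j :=
  le_iSup₂_of_le a ha (le_iSup_of_le haT le_rfl)

theorem enorm_lpProj_le_blockNorm {T t : ℝ} (hT : 0 < T) (ht : t ∈ Ico 0 T) (u : ℝ → L2) (j : ℕ) :
    ‖lpProj j (UnitAddTorus.mFourierCoeff (u t))‖ₑ ≤ blockNorm T u j := by
  have hw := window_pos hT j
  have hwT := window_le T j
  -- The window starts at `t`, unless it would overrun `T`; then it is moved back to end at `T`.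
  refine le_trans ?_ (normU2ZK_le_blockNorm (a := min t (T - window T j)) u
    (le_min ht.1 (by linarith)) (by linarith [min_le_right t (T - window T j)]))
  have hmem : t ∈ Ico (min t (T - window T j)) (min t (T - window T j) + window T j) := by
    refine ⟨min_le_left _ _, ?_⟩
    rcases min_choice t (T - window T j) with h | h <;> rw [h] <;> linarith [ht.2]
  refine le_trans (le_of_eq ?_) (enorm_le_normU2 hmem _)
  rw [← ofReal_norm, ← ofReal_norm, norm_propagator]

theorem sum_annulus_le_blockNorm_sq {T t : ℝ} (hT : 0 < T) (ht : t ∈ Ico 0 T) (u : ℝ → L2)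
    (j : ℕ) :
    ∑ k ∈ (annulus_finite j).toFinset, ‖UnitAddTorus.mFourierCoeff (u t) k‖ₑ ^ 2 ≤
      blockNorm T u j ^ 2 := by
  rw [← enorm_lpProj_sq]
  exact pow_le_pow_left' (enorm_lpProj_le_blockNorm hT ht u j) 2

theorem continuous_repr_apply (k : Fin 2 → ℤ) :
    Continuous fun f : L2 => UnitAddTorus.mFourierBasis.repr f k := by
  simp_rw [HilbertBasis.repr_apply_apply]
  exact continuous_const.inner continuous_id

/-- Countably many admissible windows cover `[0,T)`. On each, the coefficient of the twisted block
is measurable, and multiplying by the continuous phase undoes the twist. -/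
theorem aestronglyMeasurable_mFourierCoeff {T : ℝ} (hT : 0 < T) {u : ℝ → L2}
    (hu : ∀ j, blockNorm T u j ≠ ⊤) (k : Fin 2 → ℤ) :
    AEStronglyMeasurable (fun t => UnitAddTorus.mFourierCoeff (u t) k)
      (volume.restrict (Ico 0 T)) := by
  obtain ⟨j, hj⟩ := exists_mem_annulus k
  set δ := window T j with hδ
  have hδ0 : 0 < δ := window_pos hT j
  have hδT : δ ≤ T := window_le T j
  let a : ℕ → ℝ := fun n => min (n * δ) (T - δ)
  have ha0 : ∀ n, 0 ≤ a n := fun n => le_min (by positivity) (by linarith)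
  have haT : ∀ n, a n + δ ≤ T := fun n => by linarith [min_le_right (n * δ) (T - δ)]
  have hcover : Ico 0 T ⊆ ⋃ n, Ico (a n) (a n + δ) := by
    intro t ht
    rw [mem_iUnion]
    have h0 : 0 ≤ t / δ := div_nonneg ht.1 hδ0.le
    have h1 : (⌊t / δ⌋₊ : ℝ) * δ ≤ t := (le_div_iff₀ hδ0).1 (Nat.floor_le h0)
    have h2 : t < (⌊t / δ⌋₊ + 1 : ℝ) * δ := (div_lt_iff₀ hδ0).1 (Nat.lt_floor_add_one _)
    refine ⟨⌊t / δ⌋₊, (min_le_left _ _).trans h1, ?_⟩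
    rcases min_choice ((⌊t / δ⌋₊ : ℝ) * δ) (T - δ) with h | h <;> simp only [a] <;> rw [h] <;>
      linarith [ht.2]
  refine AEStronglyMeasurable.mono_measure ?_ (Measure.restrict_mono hcover le_rfl)
  rw [aestronglyMeasurable_iUnion_iff]
  intro n
  have hfin : normU2 (a n) (a n + δ) (fun t => propagator (-t)
      (lpProj j (UnitAddTorus.mFourierCoeff (u t)))) ≠ ⊤ :=
    ne_top_of_le_ne_top (hu j) (normU2ZK_le_blockNorm u (ha0 n) (haT n))
  have hm := (continuous_repr_apply k).comp_aestronglyMeasurable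
    (aestronglyMeasurable_of_normU2_ne_top hfin)
  have hexp : Continuous fun t : ℝ => Complex.exp (Complex.I * ((t * phase k : ℝ) : ℂ)) := by
    fun_prop
  refine (hexp.aestronglyMeasurable.mul hm).congr (Eventually.of_forall fun t => ?_)
  simp only [Pi.mul_apply]
  rw [repr_propagator, repr_lpProj, indicator_of_mem hj, ← mul_assoc, ← Complex.exp_add]
  simp

theorem propagator_lpProj (t : ℝ) (j : ℕ) (c : Coeffs) :
    propagator t (lpProj j c) =
      lpProj j (fun k => Complex.exp (Complex.I * ((t * phase k : ℝ) : ℂ)) * c k) := by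
  apply UnitAddTorus.mFourierBasis.repr.injective
  ext k
  rw [repr_propagator, repr_lpProj, repr_lpProj]
  by_cases hk : k ∈ annulus j <;> simp [hk]

theorem aestronglyMeasurable_propagator_lpProj_dxMul {T : ℝ} (hT : 0 < T) {u v : ℝ → L2}
    (hu : ∀ j, blockNorm T u j ≠ ⊤) (hv : ∀ j, blockNorm T v j ≠ ⊤) (J : ℕ) :
    AEStronglyMeasurable (fun t => propagator (-t) (lpProj J (dxMul (u t) (v t))))
      (volume.restrict (Ico 0 T)) := by
  have hconv : ∀ k, AEStronglyMeasurable
      (fun t => UnitAddTorus.mFourierCoeff (fun x => u t x * v t x) k)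
      (volume.restrict (Ico 0 T)) := by
    intro k
    refine aestronglyMeasurable_of_tendsto_ae (atTop : Filter (Finset (Fin 2 → ℤ)))
      (f := fun s t => ∑ m ∈ s, UnitAddTorus.mFourierCoeff (u t) (k - m) *
        UnitAddTorus.mFourierCoeff (v t) m) (fun s => ?_)
      (Eventually.of_forall fun t => hasSum_mFourierCoeff_mul (u t) (v t) k)
    exact Finset.aestronglyMeasurable_fun_sum _ fun m _ =>
      (aestronglyMeasurable_mFourierCoeff hT hu _).mul (aestronglyMeasurable_mFourierCoeff hT hv _)
  simp_rw [propagator_lpProj, lpProj]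
  refine Finset.aestronglyMeasurable_fun_sum _ fun k _ => ?_
  have hexp : Continuous fun t : ℝ => Complex.exp (Complex.I * ((-t * phase k : ℝ) : ℂ)) := by
    fun_prop
  exact (hexp.aestronglyMeasurable.mul ((hconv k).const_mul _)).smul_const _

/-! ### The estimate for one output block. -/

/-- The bound for the square of the `k`-th Fourier coefficient of `u v`, `k` of level `J`, in terms
of the energies `α`, `β` of `u`, `v` on the annuli. -/
noncomputable def convBound (α β : ℕ → ℝ≥0∞) (J : ℕ) : ℝ≥0∞ :=
  2 * ((∑' j, α j) * ∑' l, {l | J ≤ l + 1}.indicator β l +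
    (∑' j, {j | j ≤ J + 1 ∧ J ≤ j + 1}.indicator α j) * ∑' l, β l)

theorem enorm_propagator_lpProj_dxMul_sq_le {T t : ℝ} (hT : 0 < T) (ht : t ∈ Ico 0 T)
    (u v : ℝ → L2) (J : ℕ) :
    ‖propagator (-t) (lpProj J (dxMul (u t) (v t)))‖ₑ ^ 2 ≤ 100 * 16 ^ J *
      convBound (fun j => blockNorm T u j ^ 2) (fun j => blockNorm T v j ^ 2) J := by
  rw [← ofReal_norm, norm_propagator, ofReal_norm]
  exact enorm_lpProj_dxMul_sq_le fun k hk => enorm_conv_sq_le hk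
    (hasSum_mFourierCoeff_mul (u t) (v t) k) (sum_annulus_le_blockNorm_sq hT ht u)
    (sum_annulus_le_blockNorm_sq hT ht v)

/-- Bilinear estimate for a single Littlewood–Paley block of the output. -/
theorem normDU2ZK_lpProj_dxMul_sq_le {T a : ℝ} (hT : 0 < T) (u v : ℝ → L2) (J : ℕ) (ha : 0 ≤ a)
    (haT : a + window T J ≤ T)
    (hm : AEStronglyMeasurable (fun t => propagator (-t) (lpProj J (dxMul (u t) (v t))))
      (volume.restrict (Ico 0 T))) :
    normDU2ZK a (a + window T J) (fun t => lpProj J (dxMul (u t) (v t))) ^ 2 ≤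
      6400 * convBound (fun j => blockNorm T u j ^ 2) (fun j => blockNorm T v j ^ 2) J := by
  set Q := convBound (fun j => blockNorm T u j ^ 2) (fun j => blockNorm T v j ^ 2) J with hQdef
  by_cases hQ : Q = ⊤
  · rw [hQ, ENNReal.mul_top (by norm_num)]
    exact le_top
  have hsub : Ico a (a + window T J) ⊆ Ico 0 T := Ico_subset_Ico ha haT
  set M := Real.sqrt (100 * 16 ^ J * Q.toReal) with hMdef
  have hM2 : M ^ 2 = 100 * 16 ^ J * Q.toReal := Real.sq_sqrt (by positivity)
  have hbound : ∀ t ∈ Ico a (a + window T J),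
      ‖propagator (-t) (lpProj J (dxMul (u t) (v t)))‖ ≤ M := by
    intro t ht
    refine Real.le_sqrt_of_sq_le ?_
    have h := enorm_propagator_lpProj_dxMul_sq_le hT (hsub ht) u v J
    rw [← hQdef] at h
    have h' := ENNReal.toReal_mono (ENNReal.mul_ne_top (by finiteness) hQ) h
    simpa [ENNReal.toReal_mul, ENNReal.toReal_pow] using h'
  have hw := window_pos hT J
  have key := normDU2_le_of_bounded (a := a) (b := a + window T J) (by linarith)
    (Real.sqrt_nonneg _) (hm.mono_measure (Measure.restrict_mono hsub le_rfl)) hbound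
  -- The window has length at most `4⁻ᴶ`, exactly offsetting the Bernstein and derivative loss `16 ^
  -- J`. What remains is `8² * 100 = 6400`.
  have hw2 : window T J ^ 2 * 16 ^ J ≤ 1 := by
    have h1 : window T J ≤ (4 ^ J)⁻¹ := by
      refine (min_le_left _ _).trans (le_of_eq ?_)
      rw [zpow_neg, ← Nat.cast_two (R := ℤ), zpow_natCast, ← pow_mul, mul_comm J 2, pow_mul]
      norm_num
    calc window T J ^ 2 * 16 ^ J ≤ ((4 ^ J)⁻¹) ^ 2 * 16 ^ J := by gcongr
      _ = 1 := by
        rw [inv_pow, ← pow_mul, mul_comm J 2, pow_mul]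
        norm_num
  calc normDU2ZK a (a + window T J) (fun t => lpProj J (dxMul (u t) (v t))) ^ 2
      ≤ ENNReal.ofReal (8 * (M * (a + window T J - a))) ^ 2 := pow_le_pow_left' key 2
    _ = ENNReal.ofReal (6400 * Q.toReal * (window T J ^ 2 * 16 ^ J)) := by
        rw [← ENNReal.ofReal_pow (by rw [add_sub_cancel_left]; positivity)]
        congr 1
        rw [add_sub_cancel_left, mul_pow, mul_pow, hM2]
        ring
    _ ≤ ENNReal.ofReal (6400 * Q.toReal) := by
        refine ENNReal.ofReal_le_ofReal (mul_le_of_le_one_right (by positivity) hw2)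
    _ = 6400 * Q := by
        rw [ENNReal.ofReal_mul (by norm_num), ENNReal.ofReal_toReal hQ]
        norm_num

/-! ### Summation over dyadic levels. -/

/-- Tonelli: the weight is summed over output levels first, at a fixed input level. -/
theorem tsum_mul_tsum_indicator_le {E : ℕ → ℕ → Prop} {w w' β : ℕ → ℝ≥0∞} {K : ℝ≥0∞}
    (h : ∀ l, ∑' J, {J | E J l}.indicator w J ≤ K * w' l) :
    ∑' J, w J * ∑' l, {l | E J l}.indicator β l ≤ K * ∑' l, w' l * β l := by
  classical
  calc ∑' J, w J * ∑' l, {l | E J l}.indicator β l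
      = ∑' J, ∑' l, {J | E J l}.indicator w J * β l := by
        refine tsum_congr fun J => ?_
        rw [← ENNReal.tsum_mul_left]
        refine tsum_congr fun l => ?_
        by_cases hE : E J l <;> simp [indicator, hE]
    _ = ∑' l, (∑' J, {J | E J l}.indicator w J) * β l := by
        rw [ENNReal.tsum_comm]
        simp_rw [ENNReal.tsum_mul_right]
    _ ≤ ∑' l, K * w' l * β l := ENNReal.tsum_le_tsum fun l => by gcongr; exact h l
    _ = _ := by simp_rw [mul_assoc, ENNReal.tsum_mul_left]

/-- A geometric sum is comparable to its last term only for ratio above 1. With `q = 2 ^ (2 * s)`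
this is where `s > 0` is indispensable: at `q = 1` the sum is `l + 2`. -/
theorem tsum_indicator_low_pow_le {q : ℝ} (hq : 1 < q) (l : ℕ) :
    ∑' J, {J | J ≤ l + 1}.indicator (fun J => ENNReal.ofReal q ^ J) J ≤
      ENNReal.ofReal (q ^ 2 / (q - 1)) * ENNReal.ofReal q ^ l := by
  have hq0 : 0 ≤ q := by linarith
  have hq1 : 0 < q - 1 := by linarith
  rw [tsum_eq_sum (s := Finset.range (l + 2))]
  · calc _ ≤ ∑ J ∈ Finset.range (l + 2), ENNReal.ofReal q ^ J :=
          Finset.sum_le_sum fun J _ => indicator_le_self _ _ _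
      _ = ENNReal.ofReal (∑ J ∈ Finset.range (l + 2), q ^ J) := by
          rw [ENNReal.ofReal_sum_of_nonneg fun _ _ => by positivity]
          simp_rw [ENNReal.ofReal_pow hq0]
      _ ≤ ENNReal.ofReal (q ^ 2 / (q - 1) * q ^ l) := by
          refine ENNReal.ofReal_le_ofReal ?_
          rw [geom_sum_eq hq.ne', div_mul_eq_mul_div]
          gcongr
          rw [pow_add]
          linarith
      _ = _ := by rw [ENNReal.ofReal_mul (by positivity), ENNReal.ofReal_pow hq0]
  · intro J hJ
    refine indicator_of_notMem (fun h => hJ ?_) _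
    have : J ≤ l + 1 := h
    exact Finset.mem_range.2 (by omega)

theorem tsum_indicator_near_pow_le {p : ℝ≥0∞} (hp : 1 ≤ p) (j : ℕ) :
    ∑' J, {J | j ≤ J + 1 ∧ J ≤ j + 1}.indicator (fun J => p ^ J) J ≤ 3 * p * p ^ j := by
  rw [tsum_eq_sum (s := Finset.Icc (j - 1) (j + 1))]
  · calc _ ≤ ∑ J ∈ Finset.Icc (j - 1) (j + 1), p ^ (j + 1) :=
          -- At most three levels occur; the truncated `j - 1` only lowers the count when `j = 0`.
          Finset.sum_le_sum fun J hJ => (indicator_le_self _ _ _).trans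
            (pow_le_pow_right₀ hp (Finset.mem_Icc.1 hJ).2)
      _ ≤ 3 * p ^ (j + 1) := by
          rw [Finset.sum_const, nsmul_eq_mul, Nat.card_Icc]
          gcongr
          have : j + 1 + 1 - (j - 1) ≤ 3 := by omega
          exact_mod_cast this
      _ = _ := by rw [pow_succ]; ring
  · intro J hJ
    refine indicator_of_notMem (fun h => hJ ?_) _
    have : j ≤ J + 1 ∧ J ≤ j + 1 := h
    exact Finset.mem_Icc.2 (by omega)

/-- When `v` is high, `p ^ J ≤ q ^ J` is charged to `v`; when `u` is near the output level, `p ^ J`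
is charged to `u`. The uncharged factor is unweighted, which costs nothing since both weights are at
least 1. -/
theorem tsum_pow_mul_convBound_le {p q : ℝ} (hp : 1 ≤ p) (hpq : p ≤ q) (hq : 1 < q)
    (α β : ℕ → ℝ≥0∞) :
    ∑' J, ENNReal.ofReal p ^ J * convBound α β J ≤
      2 * (ENNReal.ofReal (q ^ 2 / (q - 1)) + 3 * ENNReal.ofReal p) *
        ((∑' j, ENNReal.ofReal p ^ j * α j) * ∑' l, ENNReal.ofReal q ^ l * β l) := by
  have hp' : 1 ≤ ENNReal.ofReal p := by simpa using ENNReal.ofReal_le_ofReal hp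
  have hpq' : ENNReal.ofReal p ≤ ENNReal.ofReal q := ENNReal.ofReal_le_ofReal hpq
  set U := ∑' j, ENNReal.ofReal p ^ j * α j
  set V := ∑' l, ENNReal.ofReal q ^ l * β l
  have hα : ∑' j, α j ≤ U :=
    ENNReal.tsum_le_tsum fun j => le_mul_of_one_le_left' (one_le_pow₀ hp')
  have hβ : ∑' j, β j ≤ V :=
    ENNReal.tsum_le_tsum fun j => le_mul_of_one_le_left' (one_le_pow₀ (hp'.trans hpq'))
  have h1 : ∑' J, ENNReal.ofReal p ^ J * ∑' l, {l | J ≤ l + 1}.indicator β l ≤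
      ENNReal.ofReal (q ^ 2 / (q - 1)) * V :=
    (ENNReal.tsum_le_tsum fun J => by gcongr).trans
      (tsum_mul_tsum_indicator_le (E := fun J l => J ≤ l + 1) (w := fun J => ENNReal.ofReal q ^ J)
        (tsum_indicator_low_pow_le hq))
  have h2 : ∑' J, ENNReal.ofReal p ^ J * ∑' j, {j | j ≤ J + 1 ∧ J ≤ j + 1}.indicator α j ≤
      3 * ENNReal.ofReal p * U :=
    tsum_mul_tsum_indicator_le (E := fun J j => j ≤ J + 1 ∧ J ≤ j + 1)
      (tsum_indicator_near_pow_le hp')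
  calc ∑' J, ENNReal.ofReal p ^ J * convBound α β J
      = 2 * ((∑' j, α j) *
            ∑' J, ENNReal.ofReal p ^ J * ∑' l, {l | J ≤ l + 1}.indicator β l +
          (∑' J, ENNReal.ofReal p ^ J * ∑' j, {j | j ≤ J + 1 ∧ J ≤ j + 1}.indicator α j) *
            ∑' l, β l) := by
        rw [← ENNReal.tsum_mul_left, ← ENNReal.tsum_mul_right, ← ENNReal.tsum_add,
          ← ENNReal.tsum_mul_left]
        refine tsum_congr fun J => ?_
        rw [convBound]
        ring
    _ ≤ 2 * (U * (ENNReal.ofReal (q ^ 2 / (q - 1)) * V) + 3 * ENNReal.ofReal p * U * V) := by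
        gcongr
    _ = _ := by ring

/-! ### Assembly of the bilinear estimate. -/

theorem ofReal_two_pow_rpow (s : ℝ) (j : ℕ) :
    ENNReal.ofReal (((2 : ℝ) ^ j) ^ (2 * s)) = ENNReal.ofReal ((2 : ℝ) ^ (2 * s)) ^ j := by
  rw [← ENNReal.ofReal_pow (by positivity), ← Real.rpow_natCast, ← Real.rpow_natCast,
    ← Real.rpow_mul (by norm_num), ← Real.rpow_mul (by norm_num), mul_comm]

theorem normF_eq (T s : ℝ) (u : ℝ → L2) :
    normF T s u =
      (∑' j, ENNReal.ofReal ((2 : ℝ) ^ (2 * s)) ^ j * blockNorm T u j ^ 2) ^ (1 / 2 : ℝ) := by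
  simp_rw [← ofReal_two_pow_rpow]
  rfl

/-- The short-time bilinear estimate, with the regularity `σ ∈ [0, s]` on the output and on the
first factor. -/
theorem exists_normN_dxMul_le {s σ : ℝ} (hs : 0 < s) (hσ : 0 ≤ σ) (hσs : σ ≤ s) :
    ∃ C : ℝ≥0, ∀ T : ℝ, 0 < T → ∀ u v : ℝ → L2,
      normN T σ (fun t => dxMul (u t) (v t)) ≤ C * (normF T σ u * normF T s v) := by
  set p : ℝ := 2 ^ (2 * σ) with hpdef
  set q : ℝ := 2 ^ (2 * s) with hqdef
  have hp : 1 ≤ p := Real.one_le_rpow one_le_two (by linarith)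
  have hpq : p ≤ q := Real.rpow_le_rpow_of_exponent_le one_le_two (by linarith)
  have hq : 1 < q := Real.one_lt_rpow one_lt_two (by linarith)
  set D : ℝ≥0∞ := 6400 * (2 * (ENNReal.ofReal (q ^ 2 / (q - 1)) + 3 * ENNReal.ofReal p)) with hD
  have hDtop : D ^ (1 / 2 : ℝ) ≠ ⊤ := ENNReal.rpow_ne_top_of_nonneg (by norm_num) (by finiteness)
  have hD0 : D ^ (1 / 2 : ℝ) ≠ 0 := by
    have : D ≠ 0 := by
      have : 0 < ENNReal.ofReal p := ENNReal.ofReal_pos.2 (by linarith)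
      positivity
    simp [this]
  refine ⟨(D ^ (1 / 2 : ℝ)).toNNReal, fun T hT u v => ?_⟩
  rw [ENNReal.coe_toNNReal hDtop]
  by_cases htop : normF T σ u * normF T s v = ⊤
  · rw [htop, ENNReal.mul_top hD0]
    exact le_top
  have hm : ∀ J, AEStronglyMeasurable
      (fun t => propagator (-t) (lpProj J (dxMul (u t) (v t)))) (volume.restrict (Ico 0 T)) := by
    have fin : ∀ {r : ℝ} {w : ℝ → L2}, normF T r w ≠ ⊤ → ∀ j, blockNorm T w j ≠ ⊤ := by
      intro r w h j hj
      rw [normF_eq] at h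
      refine h ?_
      rw [ENNReal.tsum_eq_top_of_eq_top ⟨j, ?_⟩, ENNReal.top_rpow_of_pos (by norm_num)]
      rw [hj, ENNReal.top_pow two_ne_zero, ENNReal.mul_top]
      exact pow_ne_zero _ (ENNReal.ofReal_pos.2 (by positivity)).ne'
    have zero : ∀ {r : ℝ} {w : ℝ → L2}, normF T r w = 0 → ∀ j, blockNorm T w j = 0 := by
      intro r w h j
      rw [normF_eq, ENNReal.rpow_eq_zero_iff_of_pos (by norm_num), ENNReal.tsum_eq_zero] at h
      have h' := (mul_eq_zero.1 (h j)).resolve_left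
        (pow_ne_zero _ (ENNReal.ofReal_pos.2 (by positivity)).ne')
      exact pow_eq_zero_iff two_ne_zero |>.1 h'
    intro J
    -- If one norm vanishes, the other may be infinite, as `0 * ⊤ = 0`, and its function
    -- non-measurable. The output block is then zero on `[0,T)`. Otherwise a finite product makes
    -- both norms finite.
    by_cases h0 : normF T σ u = 0 ∨ normF T s v = 0
    · refine (aestronglyMeasurable_const (b := (0 : L2))).congr
        ((ae_restrict_iff' measurableSet_Ico).2 (Eventually.of_forall fun t ht => ?_))
      have h := enorm_propagator_lpProj_dxMul_sq_le hT ht u v J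
      have hb : convBound (fun j => blockNorm T u j ^ 2) (fun j => blockNorm T v j ^ 2) J = 0 := by
        rcases h0 with h0 | h0 <;> simp [convBound, zero h0]
      rw [hb, mul_zero, nonpos_iff_eq_zero, pow_eq_zero_iff two_ne_zero, enorm_eq_zero] at h
      exact h.symm
    · push Not at h0
      refine aestronglyMeasurable_propagator_lpProj_dxMul hT (fin (r := σ) fun h => htop ?_)
        (fin (r := s) fun h => htop ?_) J
      · rw [h, ENNReal.top_mul h0.2]
      · rw [h, ENNReal.mul_top h0.1]
  have hsum : ∑' J, ENNReal.ofReal (((2 : ℝ) ^ J) ^ (2 * σ)) *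
      (⨆ (a : ℝ) (_ : 0 ≤ a) (_ : a + window T J ≤ T),
        normDU2ZK a (a + window T J) (fun t => lpProj J (dxMul (u t) (v t)))) ^ 2 ≤
      D * ((∑' j, ENNReal.ofReal p ^ j * blockNorm T u j ^ 2) *
        ∑' l, ENNReal.ofReal q ^ l * blockNorm T v l ^ 2) := by
    calc _ ≤ ∑' J, 6400 * (ENNReal.ofReal p ^ J *
          convBound (fun j => blockNorm T u j ^ 2) (fun j => blockNorm T v j ^ 2) J) := by
          refine ENNReal.tsum_le_tsum fun J => ?_
          rw [ofReal_two_pow_rpow, mul_left_comm]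
          gcongr
          -- The square is moved to the other side as a root, so that the supremum can be bounded
          -- window by window.
          rw [← ENNReal.rpow_two, ← ENNReal.le_rpow_inv_iff two_pos]
          refine iSup₂_le fun a ha => iSup_le fun haT => ?_
          rw [ENNReal.le_rpow_inv_iff two_pos, ENNReal.rpow_two]
          exact normDU2ZK_lpProj_dxMul_sq_le hT u v J ha haT (hm J)
      _ ≤ _ := by
          rw [ENNReal.tsum_mul_left, hD, mul_assoc]
          gcongr
          exact tsum_pow_mul_convBound_le hp hpq hq _ _
  rw [normF_eq, normF_eq, ← ENNReal.mul_rpow_of_nonneg _ _ (by norm_num),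
    ← ENNReal.mul_rpow_of_nonneg _ _ (by norm_num)]
  exact ENNReal.rpow_le_rpow hsum (by norm_num)

end ZK

theorem mainTheorem6 (s : ℝ) (hs : 0 < s) :
    ∃ C : NNReal, ∀ T : ℝ, 0 < T → T ≤ 1 → ∀ u v : ℝ → ZK.L2,
      ZK.normN T s (fun t => ZK.dxMul (u t) (v t)) ≤ C * (ZK.normF T s u * ZK.normF T s v) ∧
      ZK.normN T 0 (fun t => ZK.dxMul (u t) (v t)) ≤ C * (ZK.normF T 0 u * ZK.normF T s v) := by
  obtain ⟨C₁, h₁⟩ := ZK.exists_normN_dxMul_le hs hs.le le_rfl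
  obtain ⟨C₂, h₂⟩ := ZK.exists_normN_dxMul_le hs le_rfl hs.le
  refine ⟨max C₁ C₂, fun T hT _ u v => ⟨(h₁ T hT u v).trans ?_, (h₂ T hT u v).trans ?_⟩⟩
  · gcongr
    exact le_max_left _ _
  · gcongr
    exact le_max_right _ _
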